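/- **Conventions.** $H(n,q)$ is the Hamming graph on the words of length $n$ over $\{0,\dots,q-1\}$ (words are adjacent iff they differ in exactly one position), $\bar u|\bar v$ is concatenation, and $A|s=\{\bar x|s:\bar x\in A\}$. An orthogonal array $\mathrm{OA}(N,n,q,t)$ is a multiset of $N$ words of length $n$ over $\{0,\dots,q-1\}$ such that for any $t$ positions and any prescribed symbols in them exactly $N/q^t$ of its elements have these symbols in these positions. A set $C$ of vertices of $H(n,q)$ is an $l$-fold $1$-perfect code (a $1$-perfect code if $l=1$) if every radius-$1$ ball contains exactly $l$ words of $C$; a $2$-fold $1$-perfect code is unsplittable if it is not the union of two $1$-perfect codes. A set $C\subseteq\{0,1\}^n$ is a punctured $1$-perfect code if $C=C'\cup C''$ for some $C',C''$ such that $C'|0\cup C''|1$ is a $1$-perfect code. Let $M_2=\{00,01,10,12,22,23,31,33\}$ and $M_2'=\{00,01,11,12,22,23,30,33\}$, let $M_3=M_2|0\cup M_2'|1\cup\overline{M_2}|2\cup\overline{M_2'}|3$, and for $i\ge 4$ let $M_i=M_{i-1}|0\cup M_{i-1}|1\cup\overline{M_{i-1}}|2\cup\overline{M_{i-1}}|3$,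 where $\overline{M}$ denotes the complement of $M$ in the set of all words of the same length over $\{0,1,2,3\}$. Put $$\bar z_{0,0}=000,\ \bar z_{1,0}=110,\ \bar z_{2,0}=011,\ \bar z_{3,0}=101,\quad \bar z_{0,1}=111,\ \bar z_{1,1}=001,\ \bar z_{2,1}=100,\ \bar z_{3,1}=010,$$ $\bar y_{a,0,b}=\bar z_{a,b}|b$ and $\bar y_{a,1,b}=\bar z_{a,b}|(1-b)$. **Theorem.** Let $m\ge 4$ and $k=2^{m-2}$. 1. There is an orthogonal array $\mathrm{OA}(2^{2^m-m-1},\,2^m-2,\,2,\,2^{m-1}-1)$ that is a set (has no repeated elements) and is not a punctured $1$-perfect code. 2. It can be obtained as follows. (a) $M_k$ is an unsplittable $2$-fold MDS code: every line of $H(k,4)$ (a set of all words that agree with a given word in all positions except possibly one given position) contains exactly two words of $M_k$, and $M_k$ cannot be partitioned into two independent sets of $H(k,4)$. Moreover, for every $\bar x\in\{0,1,2,3\}^{k-1}$, $\bar x|0\in M_k$ if and only if $\bar x|1\in M_k$, and $\bar x|2\in M_k$ if and only if $\bar x|3\in M_k$. (b) There is a $1$-perfect code in $\{0,1\}^{k-1}$,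 and for every such code $P$ the set $$D=\big\{\bar y_{a_1,c_1,b_1}|\cdots|\bar y_{a_{k-1},c_{k-1},b_{k-1}}|\bar z_{a_k,b_k}:\ (a_1,\dots,a_k)\in M_k,\ (c_1,\dots,c_{k-1})\in P,\ (b_1,\dots,b_k)\in\{0,1\}^k\big\}$$ is an unsplittable $2$-fold $1$-perfect code in $\{0,1\}^{2^m-1}$ that is invariant under flipping the last coordinate ($\bar x|0\in D$ if and only if $\bar x|1\in D$), and its shortening $\{\bar x:\bar x|0\in D\}$ in the last position is an $\mathrm{OA}(2^{2^m-m-1},\,2^m-2,\,2,\,2^{m-1}-1)$ that is not a punctured $1$-perfect code. -/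

import Mathlib

namespace PhelpsArray

/-- The words of length `n` over the alphabet `{0, …, q - 1}`: the vertices of `H(n, q)`. -/
abbrev Word (n q : ℕ) : Type := Fin n → Fin q

/-- The Hamming graph `H(n, q)`: two words are adjacent iff they differ in exactly one position. -/
def hammingGraph (n q : ℕ) : SimpleGraph (Word n q) where
  Adj x y := hammingDist x y = 1
  symm := ⟨fun x y h => by rw [hammingDist_comm]; exact h⟩
  loopless := ⟨fun x h => by simp at h⟩

/-- The word `x|s`: the symbol `s` is appended at the end of `x`. -/
def push {n q : ℕ} (x : Word n q) (s : Fin q) : Word (n + 1) q :=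
  Fin.snoc (α := fun _ => Fin q) x s

/-- The set `A|s` of all words `x|s` with `x ∈ A`. -/
def pushAll {n q : ℕ} (A : Finset (Word n q)) (s : Fin q) : Finset (Word (n + 1) q) :=
  A.image fun x => push x s

/-- `s`-shortening in the last position: keep the words of `A` that end in `s`, and delete
that last symbol. -/
def shorten {n q : ℕ} (A : Finset (Word (n + 1) q)) (s : Fin q) : Finset (Word n q) :=
  Finset.univ.filter fun x => push x s ∈ A

/-- The multiset `C` of words is an orthogonal array `OA(N, n, q, t)`: it has `N` elements, and
for any `t` positions and any prescribed symbols in these positions, exactly `N / q ^ t` elements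
of `C`, counted with multiplicities, have the prescribed symbols there. (The words with prescribed
symbols in `t` positions are the vertices of a subgraph `H(n - t, q)` of `H(n, q)`.) -/
structure IsOrthogonalArray (N n q t : ℕ) (C : Multiset (Word n q)) : Prop where
  strength_le : t ≤ n
  card_eq : C.card = N
  count_eq : ∀ S : Finset (Fin n), S.card = t → ∀ v : Word n q,
    C.countP (fun x => ∀ i ∈ S, x i = v i) * q ^ t = N

/-- `C` is an `l`-fold `1`-perfect code in `H(n, q)`: every ball of radius `1` contains exactly
`l` words of `C`. -/
def IsPerfectCode {n q : ℕ} (l : ℕ) (C : Finset (Word n q)) : Prop :=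
  ∀ x : Word n q, (C.filter fun y => hammingDist x y ≤ 1).card = l

/-- `C` is the union of two `1`-perfect codes. -/
def IsSplittable {n q : ℕ} (C : Finset (Word n q)) : Prop :=
  ∃ A B : Finset (Word n q), IsPerfectCode 1 A ∧ IsPerfectCode 1 B ∧ C = A ∪ B

/-- `C = C' ∪ C''` for some `C'`, `C''` such that `C'|0 ∪ C''|1` is a `1`-perfect code. -/
def IsPuncturedPerfectCode {n : ℕ} (C : Finset (Word n 2)) : Prop :=
  ∃ C' C'' : Finset (Word n 2), C = C' ∪ C'' ∧ IsPerfectCode 1 (pushAll C' 0 ∪ pushAll C'' 1)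

/-- `M` is a `2`-fold MDS code: every line of `H(k, q)` (the words that agree with `x` in all
positions except possibly the position `i`) contains exactly two words of `M`. -/
def IsTwoFoldMDS {k q : ℕ} (M : Finset (Word k q)) : Prop :=
  ∀ (x : Word k q) (i : Fin k), (M.filter fun y => ∀ j, j ≠ i → y j = x j).card = 2

/-- `M` is a union of two disjoint independent sets of the Hamming graph. -/
def IsSplittableMDS {k q : ℕ} (M : Finset (Word k q)) : Prop :=
  ∃ A B : Finset (Word k q), (hammingGraph k q).IsIndepSet (A : Set (Word k q)) ∧
    (hammingGraph k q).IsIndepSet (B : Set (Word k q)) ∧ Disjoint A B ∧ M = A ∪ B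

/-- The set `M₂`. -/
def M₂ : Finset (Word 2 4) :=
  {![0, 0], ![0, 1], ![1, 0], ![1, 2], ![2, 2], ![2, 3], ![3, 1], ![3, 3]}

/-- The set `M₂'`. -/
def M₂' : Finset (Word 2 4) :=
  {![0, 0], ![0, 1], ![1, 1], ![1, 2], ![2, 2], ![2, 3], ![3, 0], ![3, 3]}

/-- The sets `M_k ⊆ {0, 1, 2, 3}^k` for `k ≥ 2`; the values at `0` and `1` are placeholders.
`M₃ = M₂|0 ∪ M₂'|1 ∪ M₂ᶜ|2 ∪ M₂'ᶜ|3`, and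
`M_k = M_{k-1}|0 ∪ M_{k-1}|1 ∪ M_{k-1}ᶜ|2 ∪ M_{k-1}ᶜ|3` for `k ≥ 4`. -/
def specialMDS : (k : ℕ) → Finset (Word k 4)
  | 0 => ∅
  | 1 => ∅
  | 2 => M₂
  | 3 => pushAll M₂ 0 ∪ pushAll M₂' 1 ∪ pushAll M₂ᶜ 2 ∪ pushAll M₂'ᶜ 3
  | k + 4 => pushAll (specialMDS (k + 3)) 0 ∪ pushAll (specialMDS (k + 3)) 1 ∪
      pushAll (specialMDS (k + 3))ᶜ 2 ∪ pushAll (specialMDS (k + 3))ᶜ 3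

/-- The enumeration `z a b` (`a = 0, 1, 2, 3`, `b = 0, 1`) of the binary words of length `3`. -/
def z : Fin 4 → Fin 2 → Word 3 2 :=
  ![![![0, 0, 0], ![1, 1, 1]],
    ![![1, 1, 0], ![0, 0, 1]],
    ![![0, 1, 1], ![1, 0, 0]],
    ![![1, 0, 1], ![0, 1, 0]]]

/-- `y a 0 b = z a b|b` enumerates the even-weight and `y a 1 b = z a b|(1 - b)` the odd-weight
binary words of length `4`. -/
def y (a : Fin 4) (c b : Fin 2) : Word 4 2 :=
  push (z a b) (if c = 0 then b else 1 - b)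

/-- For `N = 4 * r + 3` (the only length at which it is used), the concatenation
`y a₁ c₁ b₁ | … | y a_r c_r b_r | z a_{r+1} b_{r+1}`: position `j` (counted from `0`) lies in
the block number `j / 4`, and it is the position number `j % 4` of that block. -/
def phelpsWord (N : ℕ) {r : ℕ} (a : Word (r + 1) 4) (c : Word r 2) (b : Word (r + 1) 2) :
    Word N 2 := fun j =>
  if h : (j : ℕ) / 4 < r then
    y (a (Fin.castSucc ⟨(j : ℕ) / 4, h⟩)) (c ⟨(j : ℕ) / 4, h⟩) (b (Fin.castSucc ⟨(j : ℕ) / 4, h⟩))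
      ⟨(j : ℕ) % 4, Nat.mod_lt _ (by norm_num)⟩
  else z (a (Fin.last r)) (b (Fin.last r)) (Fin.ofNat 3 ((j : ℕ) % 4))

/-- The Phelps-type construction: all concatenations with `a ∈ M`, `c ∈ P` and arbitrary `b`.
It is used at `N = 4 * r + 3` only. -/
def phelpsCode (N : ℕ) {r : ℕ} (M : Finset (Word (r + 1) 4)) (P : Finset (Word r 2)) :
    Finset (Word N 2) :=
  (M ×ˢ P ×ˢ (Finset.univ : Finset (Word (r + 1) 2))).image
    fun w => phelpsWord N w.1 w.2.1 w.2.2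

end PhelpsArray

/-!
The code `D` lives over the pairs `(a, c)` with `a ∈ M_k` and `c ∈ P`: every binary word of length
`4 * (k - 1) + 3` is a concatenation `y a₁ c₁ b₁ | … | z a_k b_k` in a unique way
(`mem_phelpsCode`). Flipping a bit of the block `i < k` flips `c_i`, and the four bits of the block
lead to the four values of `a_i`; flipping a bit of the last block keeps `c`, and the three bits
lead to the three other values of `a_k`. So the code words in a ball correspond to the words of
`M_k` on a line whose direction is determined by the codeword of `P` closest to `c`, and there are
two of them (`isPerfectCode_phelpsCode`).

For fixed `b` and `c`, the word is a function of `a` that at most doubles distances, while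
codewords of a `1`-perfect code are at distance at least `3`. Hence a splitting of `D` would split
`M_k` into two independent sets (`not_isSplittable_phelpsCode`), and this is impossible because
`M_k` contains a copy of `M_3`, which contains a cycle of length `7`
(`not_isSplittableMDS_specialMDS`).

Since `M_k` is invariant under exchanging `0 ↔ 1` and `2 ↔ 3` in the last position, `D = E|0 ∪ E|1`
for the shortening `E`. If `E` were a punctured code `C' ∪ C''`, then `D` would be the union of the
`1`-perfect codes `C'|0 ∪ C''|1` and `C''|0 ∪ C'|1` (`not_isPuncturedPerfectCode_shorten`).

It remains to find the strength of `E`. By the ball condition for `D`, a vertex of `H(n, 2)` has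
no neighbours in `E` if it is in `E`, and two otherwise (`ball_count_shorten`). Fix a set `S` of `t`
positions, and let `F v` be the number of words of `E` that agree with `v` on `S`. Summing the
local condition over a subcube gives `(n - t + 2) F(v) + ∑_{i ∈ S} F(v + e_i) = 2 ^ (n - t + 1)`.
This system has a dominant diagonal if `2 t < n + 2`, so its only solution is the constant one, by
comparison of the maximum and the minimum of `F` (`card_subcube_inter`). With `n + 2 = 2 ^ m` the
condition on `t` reads `t ≤ 2 ^ (m - 1) - 1`.
-/

namespace PhelpsArray

/-! ### Appending and flipping symbols -/

@[simp] lemma push_castSucc {n q : ℕ} (x : Word n q) (s : Fin q) (i : Fin n) :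
    push x s i.castSucc = x i := by simp [push]

@[simp] lemma push_last {n q : ℕ} (x : Word n q) (s : Fin q) :
    push x s (Fin.last n) = s := by simp [push]

lemma exists_eq_push {n q : ℕ} (w : Word (n + 1) q) : ∃ x s, w = push x s :=
  ⟨Fin.init w, w (Fin.last n), (Fin.snoc_init_self (α := fun _ => Fin q) w).symm⟩

lemma push_inj {n q : ℕ} {x x' : Word n q} {s s' : Fin q} :
    push x s = push x' s' ↔ x = x' ∧ s = s' := Fin.snoc_inj

lemma update_push_castSucc {n q : ℕ} (x : Word n q) (s t : Fin q) (i : Fin n) :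
    Function.update (push x s) i.castSucc t = push (Function.update x i t) s :=
  (Fin.snoc_update (α := fun _ => Fin q) s x i t).symm

lemma update_push_last {n q : ℕ} (x : Word n q) (s t : Fin q) :
    Function.update (push x s) (Fin.last n) t = push x t :=
  Fin.update_snoc_last (α := fun _ => Fin q) s x t

lemma push_mem_pushAll {n q : ℕ} {A : Finset (Word n q)} {x : Word n q} {s t : Fin q} :
    push x s ∈ pushAll A t ↔ s = t ∧ x ∈ A := by
  simp only [pushAll, Finset.mem_image, push_inj]
  constructor
  · rintro ⟨y, hy, rfl, rfl⟩
    exact ⟨rfl, hy⟩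
  · rintro ⟨rfl, hx⟩
    exact ⟨x, hx, rfl, rfl⟩

lemma hammingDist_push {n q : ℕ} (x x' : Word n q) (s : Fin q) :
    hammingDist (push x s) (push x' s) = hammingDist x x' := by
  simp only [hammingDist, Finset.card_filter, Fin.sum_univ_castSucc, push_castSucc, push_last]
  simp

/-- The binary word `x` with the symbol in the position `i` changed. -/
def flip {n : ℕ} (x : Word n 2) (i : Fin n) : Word n 2 :=
  Function.update x i (x i + 1)

@[simp] lemma flip_self {n : ℕ} (x : Word n 2) (i : Fin n) : flip x i i = x i + 1 := by
  simp [flip]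

lemma flip_of_ne {n : ℕ} (x : Word n 2) {i j : Fin n} (h : j ≠ i) : flip x i j = x j := by
  simp [flip, h]

lemma ne_iff_eq_add_one : ∀ a b : Fin 2, a ≠ b ↔ b = a + 1 := by decide

@[simp] lemma flip_flip {n : ℕ} (x : Word n 2) (i : Fin n) : flip (flip x i) i = x := by
  have h : ∀ a : Fin 2, a + 1 + 1 = a := by decide
  simp [flip, h]

lemma flip_push_castSucc {n : ℕ} (x : Word n 2) (s : Fin 2) (i : Fin n) :
    flip (push x s) i.castSucc = push (flip x i) s := by
  simp [flip, update_push_castSucc]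

lemma flip_push_last {n : ℕ} (x : Word n 2) (s : Fin 2) :
    flip (push x s) (Fin.last n) = push x (s + 1) := by
  simp [flip, update_push_last]

lemma flip_injective {n : ℕ} (x : Word n 2) : Function.Injective (flip x) := by
  intro i j h
  by_contra hij
  have h' := congrFun h i
  rw [flip_self, flip_of_ne x hij] at h'
  exact absurd rfl ((ne_iff_eq_add_one _ _).2 h'.symm)

lemma flip_ne {n : ℕ} (x : Word n 2) (i : Fin n) : flip x i ≠ x := by
  intro h
  have h' := congrFun h i
  rw [flip_self] at h'
  exact absurd rfl ((ne_iff_eq_add_one _ _).2 h'.symm)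

lemma hammingDist_flip {n : ℕ} (x : Word n 2) (i : Fin n) : hammingDist x (flip x i) = 1 := by
  rw [hammingDist, Finset.card_eq_one]
  refine ⟨i, ?_⟩
  ext j
  by_cases h : j = i
  · subst h
    simp [ne_iff_eq_add_one]
  · simp [h, flip_of_ne]

/-- A ball of radius `1` consists of its centre and the words obtained by flipping one symbol. -/
lemma hammingDist_le_one_iff {n : ℕ} (x w : Word n 2) :
    hammingDist x w ≤ 1 ↔ w = x ∨ ∃ i, w = flip x i := by
  constructor
  · intro h
    rw [hammingDist, Finset.card_le_one] at h
    by_cases hx : w = x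
    · exact Or.inl hx
    · obtain ⟨i, hi⟩ := Function.ne_iff.1 hx
      refine Or.inr ⟨i, funext fun j => ?_⟩
      by_cases hj : j = i
      · subst hj
        rw [flip_self]
        exact (ne_iff_eq_add_one _ _).1 hi.symm
      · rw [flip_of_ne x hj]
        by_contra hne
        exact hj (h j (by simpa using Ne.symm hne) i (by simpa using hi.symm))
  · rintro (rfl | ⟨i, rfl⟩)
    · simp
    · exact (hammingDist_flip x i).le

lemma card_ball_inter {n : ℕ} (C : Finset (Word n 2)) (x : Word n 2) :
    (C.filter fun w => hammingDist x w ≤ 1).card =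
      (if x ∈ C then 1 else 0) + ∑ i, if flip x i ∈ C then 1 else 0 := by
  have h : C.filter (fun w => hammingDist x w ≤ 1) =
      ({x} : Finset (Word n 2)).filter (· ∈ C) ∪
        (Finset.univ.image (flip x)).filter (· ∈ C) := by
    ext w
    simp only [Finset.mem_filter, hammingDist_le_one_iff, Finset.mem_union,
      Finset.mem_singleton, Finset.mem_image, Finset.mem_univ, true_and, eq_comm (a := w)]
    tauto
  rw [h, Finset.card_union_of_disjoint]
  · rw [Finset.card_filter, Finset.card_filter, Finset.sum_singleton,
      Finset.sum_image fun i _ j _ h => flip_injective x h]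
  · refine Finset.disjoint_filter_filter ?_
    rw [Finset.disjoint_singleton_left]
    simp [flip_ne]

lemma isPerfectCode_iff {n l : ℕ} (C : Finset (Word n 2)) :
    IsPerfectCode l C ↔ ∀ x : Word n 2,
      ((if x ∈ C then 1 else 0) + ∑ i, if flip x i ∈ C then 1 else 0) = l := by
  simp only [IsPerfectCode, card_ball_inter]

/-- Distinct codewords of a `1`-perfect code have disjoint balls, so they are at distance at
least `3`. -/
lemma IsPerfectCode.eq_of_hammingDist_le_two {n q : ℕ} {A : Finset (Word n q)}
    (hA : IsPerfectCode 1 A) {u v : Word n q} (hu : u ∈ A) (hv : v ∈ A)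
    (h : hammingDist u v ≤ 2) : u = v := by
  by_contra hne
  obtain ⟨i, hi⟩ := Function.ne_iff.1 hne
  -- A word between `u` and `v` has both of them in its ball.
  obtain ⟨p, hp⟩ := Finset.card_eq_one.1 (hA (Function.update u i (v i)))
  have h1 : hammingDist (Function.update u i (v i)) u ≤ 1 := by
    rw [hammingDist, Finset.card_le_one]
    have key : ∀ j, Function.update u i (v i) j ≠ u j → j = i := by
      intro j hj
      by_contra hji
      simp [hji] at hj
    simp only [Finset.mem_filter, Finset.mem_univ, true_and]
    intro a ha b hb
    rw [key a ha, key b hb]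
  have h2 : hammingDist (Function.update u i (v i)) v ≤ 1 := by
    have hs : (Finset.univ.filter fun j => Function.update u i (v i) j ≠ v j) =
        (Finset.univ.filter fun j => u j ≠ v j).erase i := by
      ext j
      by_cases hj : j = i
      · subst hj; simp
      · simp [hj]
    rw [hammingDist, hs, Finset.card_erase_of_mem (by simpa using hi)]
    rw [hammingDist] at h
    omega
  have hu' : u ∈ ({p} : Finset _) := hp ▸ Finset.mem_filter.2 ⟨hu, h1⟩
  have hv' : v ∈ ({p} : Finset _) := hp ▸ Finset.mem_filter.2 ⟨hv, h2⟩
  exact hne ((Finset.mem_singleton.1 hu').trans (Finset.mem_singleton.1 hv').symm)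

/-! ### Twofold MDS codes -/

lemma isTwoFoldMDS_iff {k q : ℕ} (M : Finset (Word k q)) :
    IsTwoFoldMDS M ↔
      ∀ (x : Word k q) (i : Fin k), ∑ s, (if Function.update x i s ∈ M then 1 else 0) = 2 := by
  refine forall_congr' fun x => forall_congr' fun i => ?_
  rw [← Finset.card_filter]
  suffices h : (M.filter fun w => ∀ j, j ≠ i → w j = x j) =
      (Finset.univ.filter fun s => Function.update x i s ∈ M).image (Function.update x i) by
    rw [h, Finset.card_image_of_injective _ (Function.update_injective x i)]
  ext w
  simp only [Finset.mem_filter, Finset.mem_image, Finset.mem_univ, true_and]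
  constructor
  · rintro ⟨hw, h⟩
    have hu : Function.update x i (w i) = w := by
      funext j
      by_cases hj : j = i
      · subst hj; simp
      · simp [hj, h j hj]
    exact ⟨w i, hu.symm ▸ hw, hu⟩
  · rintro ⟨s, hs, rfl⟩
    exact ⟨hs, fun j hj => by simp [hj]⟩

lemma IsTwoFoldMDS.compl {k : ℕ} {M : Finset (Word k 4)} (hM : IsTwoFoldMDS M) :
    IsTwoFoldMDS Mᶜ := by
  rw [isTwoFoldMDS_iff] at hM ⊢
  intro x i
  have h := hM x i
  simp only [Fin.sum_univ_four, Finset.mem_compl] at h ⊢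
  split_ifs at h ⊢ <;> omega

/-- A set whose sections in the last coordinate are twofold MDS codes, two of them containing
any given word, is a twofold MDS code. -/
lemma isTwoFoldMDS_of_sections {k q : ℕ} {M : Finset (Word (k + 1) q)}
    (T : Fin q → Finset (Word k q)) (h : ∀ x s, push x s ∈ M ↔ x ∈ T s)
    (hT : ∀ s, IsTwoFoldMDS (T s)) (hx : ∀ x, ∑ s, (if x ∈ T s then 1 else 0) = 2) :
    IsTwoFoldMDS M := by
  simp only [isTwoFoldMDS_iff] at hT ⊢
  intro w i
  obtain ⟨x, s, rfl⟩ := exists_eq_push w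
  refine Fin.lastCases ?_ (fun i => ?_) i
  · simpa only [update_push_last, h] using hx x
  · simpa only [update_push_castSucc, h] using hT s x i

lemma IsSplittableMDS.section {k q : ℕ} {M : Finset (Word (k + 1) q)} {T : Finset (Word k q)}
    (s : Fin q) (h : ∀ x, push x s ∈ M ↔ x ∈ T) (hM : IsSplittableMDS M) :
    IsSplittableMDS T := by
  obtain ⟨A, B, hA, hB, hAB, rfl⟩ := hM
  have key : ∀ C : Finset (Word (k + 1) q),
      (hammingGraph (k + 1) q).IsIndepSet (C : Set (Word (k + 1) q)) →
      (hammingGraph k q).IsIndepSet (shorten C s : Set (Word k q)) := by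
    intro C hC x hx x' hx' hne hadj
    refine hC (by simpa [shorten] using hx) (by simpa [shorten] using hx')
      (fun he => hne (push_inj.1 he).1) ?_
    change hammingDist _ _ = 1
    rw [hammingDist_push]
    exact hadj
  refine ⟨shorten A s, shorten B s, key A hA, key B hB, ?_, ?_⟩
  · rw [Finset.disjoint_left] at hAB ⊢
    intro x hx hx'
    exact hAB (by simpa [shorten] using hx) (by simpa [shorten] using hx')
  · ext x
    rw [← h x]
    simp [shorten]

lemma isTwoFoldMDS_M₂ : IsTwoFoldMDS M₂ := by
  rw [isTwoFoldMDS_iff]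
  decide

lemma isTwoFoldMDS_M₂' : IsTwoFoldMDS M₂' := by
  rw [isTwoFoldMDS_iff]
  decide

lemma push_mem_specialMDS_three (x : Word 2 4) (s : Fin 4) :
    push x s ∈ specialMDS 3 ↔ x ∈ (![M₂, M₂', M₂ᶜ, M₂'ᶜ] : Fin 4 → Finset (Word 2 4)) s := by
  simp only [specialMDS, Finset.mem_union, push_mem_pushAll]
  fin_cases s <;> simp

lemma push_mem_specialMDS_add_four (k : ℕ) (x : Word (k + 3) 4) (s : Fin 4) :
    push x s ∈ specialMDS (k + 4) ↔
      x ∈ (![specialMDS (k + 3), specialMDS (k + 3), (specialMDS (k + 3))ᶜ,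
        (specialMDS (k + 3))ᶜ] : Fin 4 → Finset (Word (k + 3) 4)) s := by
  simp only [specialMDS, Finset.mem_union, push_mem_pushAll]
  fin_cases s <;> simp

lemma isTwoFoldMDS_specialMDS (k : ℕ) : IsTwoFoldMDS (specialMDS (k + 3)) := by
  induction k with
  | zero =>
    refine isTwoFoldMDS_of_sections _ push_mem_specialMDS_three (fun s => ?_) fun x => ?_
    · fin_cases s
      exacts [isTwoFoldMDS_M₂, isTwoFoldMDS_M₂', isTwoFoldMDS_M₂.compl, isTwoFoldMDS_M₂'.compl]
    · by_cases h : x ∈ M₂ <;> by_cases h' : x ∈ M₂' <;>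
        rw [Fin.sum_univ_four] <;> simp [h, h']
  | succ k ih =>
    refine isTwoFoldMDS_of_sections _ (push_mem_specialMDS_add_four k) (fun s => ?_) fun x => ?_
    · fin_cases s
      exacts [ih, ih, ih.compl, ih.compl]
    · by_cases h : x ∈ specialMDS (k + 3) <;> rw [Fin.sum_univ_four] <;> simp [h]

/-- `M₃` contains a cycle of length `7` of the Hamming graph. -/
lemma not_isSplittableMDS_specialMDS_three : ¬ IsSplittableMDS (specialMDS 3) := by
  rintro ⟨A, B, hA, hB, hAB, hM⟩
  have key : ∀ u v : Word 3 4, hammingDist u v = 1 → v ∈ specialMDS 3 →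
      (u ∈ A → v ∈ B) ∧ (u ∈ B → v ∈ A) := by
    intro u v huv hv
    have hne : u ≠ v := by
      rintro rfl
      simp at huv
    rw [hM, Finset.mem_union] at hv
    exact ⟨fun hu => hv.resolve_left fun hvA => hA hu hvA hne huv,
      fun hu => hv.resolve_right fun hvB => hB hu hvB hne huv⟩
  have h01 := key ![0, 1, 0] ![0, 1, 1] (by decide) (by decide)
  have h12 := key ![0, 1, 1] ![1, 1, 1] (by decide) (by decide)
  have h23 := key ![1, 1, 1] ![1, 2, 1] (by decide) (by decide)
  have h34 := key ![1, 2, 1] ![1, 2, 0] (by decide) (by decide)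
  have h45 := key ![1, 2, 0] ![1, 0, 0] (by decide) (by decide)
  have h56 := key ![1, 0, 0] ![0, 0, 0] (by decide) (by decide)
  have h60 := key ![0, 0, 0] ![0, 1, 0] (by decide) (by decide)
  have h0 : (![0, 1, 0] : Word 3 4) ∈ A ∪ B := hM ▸ (by decide)
  -- Going once around the cycle moves the starting word to the other part.
  rcases Finset.mem_union.1 h0 with h | h
  · exact Finset.disjoint_left.1 hAB h
      (h60.1 (h56.2 (h45.1 (h34.2 (h23.1 (h12.2 (h01.1 h)))))))
  · exact Finset.disjoint_left.1 hAB
      (h60.2 (h56.1 (h45.2 (h34.1 (h23.2 (h12.1 (h01.2 h))))))) h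

lemma not_isSplittableMDS_specialMDS (k : ℕ) : ¬ IsSplittableMDS (specialMDS (k + 3)) := by
  induction k with
  | zero => exact not_isSplittableMDS_specialMDS_three
  | succ k ih =>
    exact fun h => ih (h.section 0 fun x => push_mem_specialMDS_add_four k x 0)

/-! ### The Phelps construction in blocks -/

/-- The position number `p` of the block number `i`, among `r` blocks of length `4`. -/
def pos {r : ℕ} (i : Fin r) (p : Fin 4) : Fin (r * 4 + 3) := Fin.castAdd 3 (finProdFinEquiv (i, p))

/-- The position number `p` of the last block, which has length `3`. -/
def lastPos {r : ℕ} (p : Fin 3) : Fin (r * 4 + 3) := Fin.natAdd (r * 4) p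

lemma pos_inj {r : ℕ} {i i' : Fin r} {p p' : Fin 4} : pos i p = pos i' p' ↔ i = i' ∧ p = p' := by
  simp [pos, Prod.ext_iff]

lemma lastPos_inj {r : ℕ} {p p' : Fin 3} : (lastPos p : Fin (r * 4 + 3)) = lastPos p' ↔ p = p' := by
  simp [lastPos]

lemma pos_ne_lastPos {r : ℕ} (i : Fin r) (p : Fin 4) (p' : Fin 3) : pos i p ≠ lastPos p' := by
  intro h
  have h' := congrArg Fin.val h
  have := (finProdFinEquiv (i, p)).isLt
  simp only [pos, lastPos, Fin.val_castAdd, Fin.val_natAdd] at h'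
  omega

lemma sum_positions {r : ℕ} (g : Fin (r * 4 + 3) → ℕ) :
    ∑ j, g j = ∑ i, ∑ p, g (pos i p) + ∑ p, g (lastPos p) := by
  rw [Fin.sum_univ_add, ← Equiv.sum_comp finProdFinEquiv, Fintype.sum_prod_type]
  rfl

/-- The block number `i` of a word. -/
def block {r : ℕ} (w : Word (r * 4 + 3) 2) (i : Fin r) : Word 4 2 := fun p => w (pos i p)

/-- The last block of a word. -/
def lastBlock {r : ℕ} (w : Word (r * 4 + 3) 2) : Word 3 2 := fun p => w (lastPos p)

lemma ext_blocks {r : ℕ} {w w' : Word (r * 4 + 3) 2} (h : ∀ i, block w i = block w' i)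
    (h' : lastBlock w = lastBlock w') : w = w' := by
  funext j
  refine Fin.addCases (fun j => ?_) (fun p => congrFun h' p) j
  obtain ⟨⟨i, p⟩, rfl⟩ := finProdFinEquiv.surjective j
  exact congrFun (h i) p

lemma block_phelpsWord {r : ℕ} (a : Word (r + 1) 4) (c : Word r 2) (b : Word (r + 1) 2)
    (i : Fin r) :
    block (phelpsWord (r * 4 + 3) a c b) i = y (a i.castSucc) (c i) (b i.castSucc) := by
  funext p
  have h1 : ((p : ℕ) + 4 * i) / 4 = i := by omega
  have h2 : ((p : ℕ) + 4 * i) % 4 = p := by omega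
  simp [block, phelpsWord, pos, h1, h2]

lemma lastBlock_phelpsWord {r : ℕ} (a : Word (r + 1) 4) (c : Word r 2) (b : Word (r + 1) 2) :
    lastBlock (phelpsWord (r * 4 + 3) a c b) = z (a (Fin.last r)) (b (Fin.last r)) := by
  funext p
  have h1 : ¬ (r * 4 + (p : ℕ)) / 4 < r := by omega
  have h2 : (r * 4 + (p : ℕ)) % 4 = p := by omega
  have h3 : Fin.ofNat 3 (p : ℕ) = p := by
    ext
    simp [Fin.ofNat, Nat.mod_eq_of_lt p.isLt]
  simp only [lastBlock, phelpsWord, lastPos, Fin.val_natAdd, h1, h2, h3, dite_false]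

lemma y_bijective : Function.Bijective fun t : Fin 4 × Fin 2 × Fin 2 => y t.1 t.2.1 t.2.2 := by
  decide

lemma z_bijective : Function.Bijective fun t : Fin 4 × Fin 2 => z t.1 t.2 := by decide

/-- The inverse of the enumeration `y` of the binary words of length `4`. -/
noncomputable def yInv : Word 4 2 → Fin 4 × Fin 2 × Fin 2 :=
  (Equiv.ofBijective _ y_bijective).symm

/-- The inverse of the enumeration `z` of the binary words of length `3`. -/
noncomputable def zInv : Word 3 2 → Fin 4 × Fin 2 := (Equiv.ofBijective _ z_bijective).symm

@[simp] lemma yInv_y (a : Fin 4) (c b : Fin 2) : yInv (y a c b) = (a, c, b) :=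
  (Equiv.ofBijective _ y_bijective).symm_apply_apply (a, c, b)

@[simp] lemma zInv_z (a : Fin 4) (b : Fin 2) : zInv (z a b) = (a, b) :=
  (Equiv.ofBijective _ z_bijective).symm_apply_apply (a, b)

lemma y_yInv (u : Word 4 2) : y (yInv u).1 (yInv u).2.1 (yInv u).2.2 = u :=
  (Equiv.ofBijective _ y_bijective).apply_symm_apply u

lemma z_zInv (u : Word 3 2) : z (zInv u).1 (zInv u).2 = u :=
  (Equiv.ofBijective _ z_bijective).apply_symm_apply u

/-- The word `a` of a concatenation `y a₁ c₁ b₁ | … | z a_{r+1} b_{r+1}`. -/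
noncomputable def aWord {r : ℕ} (w : Word (r * 4 + 3) 2) : Word (r + 1) 4 :=
  push (fun i => (yInv (block w i)).1) (zInv (lastBlock w)).1

/-- The word `c` of a concatenation `y a₁ c₁ b₁ | … | z a_{r+1} b_{r+1}`. -/
noncomputable def cWord {r : ℕ} (w : Word (r * 4 + 3) 2) : Word r 2 :=
  fun i => (yInv (block w i)).2.1

/-- Every word of length `4 * r + 3` has a unique representation as a concatenation
`y a₁ c₁ b₁ | … | z a_{r+1} b_{r+1}`, and membership in the code depends on `a` and `c` only. -/
lemma mem_phelpsCode {r : ℕ} {M : Finset (Word (r + 1) 4)} {P : Finset (Word r 2)}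
    {w : Word (r * 4 + 3) 2} :
    w ∈ phelpsCode (r * 4 + 3) M P ↔ aWord w ∈ M ∧ cWord w ∈ P := by
  simp only [phelpsCode, Finset.mem_image, Finset.mem_product, Finset.mem_univ, and_true,
    Prod.exists]
  constructor
  · rintro ⟨a, c, b, ⟨ha, hc⟩, rfl⟩
    have h1 : aWord (phelpsWord (r * 4 + 3) a c b) = a := by
      simp only [aWord, block_phelpsWord, lastBlock_phelpsWord, yInv_y, zInv_z]
      exact Fin.snoc_init_self (α := fun _ => Fin 4) a
    have h2 : cWord (phelpsWord (r * 4 + 3) a c b) = c := by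
      funext i
      simp [cWord, block_phelpsWord]
    rw [h1, h2]
    exact ⟨ha, hc⟩
  · rintro ⟨ha, hc⟩
    refine ⟨aWord w, cWord w,
      push (fun i => (yInv (block w i)).2.2) (zInv (lastBlock w)).2, ⟨ha, hc⟩, ?_⟩
    refine ext_blocks (fun i => ?_) ?_
    · simp [block_phelpsWord, aWord, cWord, y_yInv]
    · simp [lastBlock_phelpsWord, aWord, z_zInv]

lemma phelpsWord_mem {r : ℕ} (N : ℕ) {M : Finset (Word (r + 1) 4)} {P : Finset (Word r 2)}
    {a : Word (r + 1) 4} {c : Word r 2} (ha : a ∈ M) (hc : c ∈ P) (b : Word (r + 1) 2) :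
    phelpsWord N a c b ∈ phelpsCode N M P :=
  Finset.mem_image.2 ⟨(a, c, b), by simp [ha, hc], rfl⟩

lemma block_flip_pos {r : ℕ} (w : Word (r * 4 + 3) 2) (i : Fin r) (p : Fin 4) :
    block (flip w (pos i p)) = Function.update (block w) i (flip (block w i) p) := by
  funext i' p'
  by_cases hi : i' = i
  · subst hi
    by_cases hp : p' = p
    · subst hp
      simp [block]
    · rw [Function.update_self, flip_of_ne _ hp, block, flip_of_ne _ (by simp [pos_inj, hp])]
      rfl
  · rw [Function.update_of_ne hi, block, flip_of_ne _ (by simp [pos_inj, hi])]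
    rfl

lemma lastBlock_flip_pos {r : ℕ} (w : Word (r * 4 + 3) 2) (i : Fin r) (p : Fin 4) :
    lastBlock (flip w (pos i p)) = lastBlock w :=
  funext fun p' => flip_of_ne _ (pos_ne_lastPos i p p').symm

lemma block_flip_lastPos {r : ℕ} (w : Word (r * 4 + 3) 2) (p : Fin 3) :
    block (flip w (lastPos p)) = block w :=
  funext fun i => funext fun p' => flip_of_ne _ (pos_ne_lastPos i p' p)

lemma lastBlock_flip_lastPos {r : ℕ} (w : Word (r * 4 + 3) 2) (p : Fin 3) :
    lastBlock (flip w (lastPos p)) = flip (lastBlock w) p := by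
  funext p'
  by_cases hp : p' = p
  · subst hp
    simp [lastBlock]
  · rw [flip_of_ne _ hp, lastBlock, flip_of_ne _ (by simp [lastPos_inj, hp])]
    rfl

lemma yInv_flip_snd (u : Word 4 2) (p : Fin 4) : (yInv (flip u p)).2.1 = (yInv u).2.1 + 1 := by
  have h : ∀ a c b p, ∃ a' b', flip (y a c b) p = y a' (c + 1) b' := by decide
  obtain ⟨a', b', h⟩ := h (yInv u).1 (yInv u).2.1 (yInv u).2.2 p
  rw [y_yInv] at h
  rw [h, yInv_y]

/-- The four neighbours of a word of length `4` have four different symbols `a`: the pairs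
`{y a c 0, y a c 1}` with a given `c` consist of complementary words. -/
lemma yInv_flip_fst_bijective (u : Word 4 2) :
    Function.Bijective fun p => (yInv (flip u p)).1 := by
  have h : ∀ a c b p p' a' c' b' b'', flip (y a c b) p = y a' c' b' →
      flip (y a c b) p' = y a' c' b'' → p = p' := by decide
  rw [← Finite.injective_iff_bijective]
  intro p p' hp
  have hc : (yInv (flip u p')).2.1 = (yInv (flip u p)).2.1 := by simp only [yInv_flip_snd]
  refine h (yInv u).1 (yInv u).2.1 (yInv u).2.2 p p' (yInv (flip u p)).1
    (yInv (flip u p)).2.1 (yInv (flip u p)).2.2 (yInv (flip u p')).2.2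
    (by rw [y_yInv]; exact (y_yInv (flip u p)).symm) ?_
  dsimp only at hp
  rw [y_yInv, hp, ← hc]
  exact (y_yInv (flip u p')).symm

/-- A word of length `3` and its three neighbours have four different symbols `a`, as each pair
`{z a 0, z a 1}` is a `1`-perfect code. -/
lemma zInv_fst_ball_bijective (u : Word 3 2) :
    Function.Bijective (push (fun p => (zInv (flip u p)).1) (zInv u).1) := by
  have hinj : ∀ a b p p' a' b' b'', flip (z a b) p = z a' b' → flip (z a b) p' = z a' b'' →
      p = p' := by decide
  have hne : ∀ a b p b', flip (z a b) p ≠ z a b' := by decide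
  have hne' : ∀ p, (zInv (flip u p)).1 ≠ (zInv u).1 := by
    intro p hp
    refine hne (zInv u).1 (zInv u).2 p (zInv (flip u p)).2 ?_
    rw [z_zInv, ← hp, z_zInv]
  rw [← Finite.injective_iff_bijective]
  refine Fin.snoc_injective_iff.2 ⟨?_, ?_⟩
  · intro p p' hp
    dsimp only at hp
    refine hinj (zInv u).1 (zInv u).2 p p' (zInv (flip u p)).1
      (zInv (flip u p)).2 (zInv (flip u p')).2
      (by rw [z_zInv]; exact (z_zInv (flip u p)).symm) ?_
    rw [z_zInv, hp, z_zInv]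
  · rintro ⟨p, hp⟩
    exact hne' p hp

lemma aWord_flip_pos {r : ℕ} (w : Word (r * 4 + 3) 2) (i : Fin r) (p : Fin 4) :
    aWord (flip w (pos i p)) =
      Function.update (aWord w) i.castSucc (yInv (flip (block w i) p)).1 := by
  rw [aWord, aWord, update_push_castSucc, lastBlock_flip_pos, block_flip_pos]
  congr 1
  funext i'
  by_cases hi : i' = i
  · subst hi
    simp
  · simp [hi]

lemma aWord_flip_lastPos {r : ℕ} (w : Word (r * 4 + 3) 2) (p : Fin 3) :
    aWord (flip w (lastPos p)) =
      Function.update (aWord w) (Fin.last r) (zInv (flip (lastBlock w) p)).1 := by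
  rw [aWord, aWord, update_push_last, lastBlock_flip_lastPos, block_flip_lastPos]

lemma cWord_flip_pos {r : ℕ} (w : Word (r * 4 + 3) 2) (i : Fin r) (p : Fin 4) :
    cWord (flip w (pos i p)) = flip (cWord w) i := by
  funext i'
  rw [cWord, block_flip_pos]
  by_cases hi : i' = i
  · subst hi
    simp [yInv_flip_snd, cWord]
  · simp [hi, flip_of_ne, cWord]

lemma cWord_flip_lastPos {r : ℕ} (w : Word (r * 4 + 3) 2) (p : Fin 3) :
    cWord (flip w (lastPos p)) = cWord w := by
  funext i
  rw [cWord, block_flip_lastPos, cWord]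

/-- The code words in the ball of a word `w` with the words `a`, `c` lie over the only word `c'`
of `P` in the ball of `c`. If `c' = c`, the ball leaves the symbols of `a` but the last one fixed
and takes the last one through all four values; if `c'` differs from `c` in the position `i`, it
does the same with the symbol `i`. Each of these lines meets `M` in two words. -/
lemma isPerfectCode_phelpsCode {r : ℕ} {M : Finset (Word (r + 1) 4)} {P : Finset (Word r 2)}
    (hM : IsTwoFoldMDS M) (hP : IsPerfectCode 1 P) :
    IsPerfectCode 2 (phelpsCode (r * 4 + 3) M P) := by
  rw [isPerfectCode_iff] at hP ⊢
  rw [isTwoFoldMDS_iff] at hM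
  intro w
  have h1 : ∀ i : Fin r, ∑ p, (if flip w (pos i p) ∈ phelpsCode (r * 4 + 3) M P then 1 else 0) =
      2 * if flip (cWord w) i ∈ P then 1 else 0 := by
    intro i
    simp only [mem_phelpsCode, cWord_flip_pos, aWord_flip_pos]
    by_cases h : flip (cWord w) i ∈ P
    · simp only [h, and_true, if_true, mul_one]
      refine Eq.trans ?_ (hM (aWord w) i.castSucc)
      exact (yInv_flip_fst_bijective (block w i)).sum_comp
        fun s => if Function.update (aWord w) i.castSucc s ∈ M then 1 else 0
    · simp [h]
  have h2 : (if w ∈ phelpsCode (r * 4 + 3) M P then 1 else 0) +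
      ∑ p, (if flip w (lastPos p) ∈ phelpsCode (r * 4 + 3) M P then 1 else 0) =
      2 * if cWord w ∈ P then 1 else 0 := by
    simp only [mem_phelpsCode, cWord_flip_lastPos, aWord_flip_lastPos]
    by_cases h : cWord w ∈ P
    · simp only [h, and_true, if_true, mul_one]
      have hself : Function.update (aWord w) (Fin.last r) (zInv (lastBlock w)).1 = aWord w := by
        rw [aWord, update_push_last]
      have hsum := (zInv_fst_ball_bijective (lastBlock w)).sum_comp
        fun s => if Function.update (aWord w) (Fin.last r) s ∈ M then 1 else 0
      rw [Fin.sum_univ_castSucc, add_comm] at hsum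
      simp only [push_castSucc, push_last, hself] at hsum
      exact hsum.trans (hM (aWord w) (Fin.last r))
    · simp [h]
  rw [sum_positions, add_comm (∑ i, _), ← add_assoc, h2, Finset.sum_congr rfl fun i _ => h1 i,
    ← Finset.mul_sum, ← mul_add, hP (cWord w)]

lemma hammingDist_phelpsWord_le {r : ℕ} (a a' : Word (r + 1) 4) (c : Word r 2)
    (b : Word (r + 1) 2) :
    hammingDist (phelpsWord (r * 4 + 3) a c b) (phelpsWord (r * 4 + 3) a' c b) ≤
      2 * hammingDist a a' := by
  have hy : ∀ a a' c b, hammingDist (y a c b) (y a' c b) ≤ 2 * if a ≠ a' then 1 else 0 := by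
    decide
  have hz : ∀ a a' b, hammingDist (z a b) (z a' b) ≤ 2 * if a ≠ a' then 1 else 0 := by decide
  have hsum : ∀ w w' : Word (r * 4 + 3) 2, hammingDist w w' =
      ∑ i, hammingDist (block w i) (block w' i) + hammingDist (lastBlock w) (lastBlock w') := by
    intro w w'
    simp only [hammingDist, Finset.card_filter]
    exact sum_positions _
  rw [hsum]
  simp only [block_phelpsWord, lastBlock_phelpsWord]
  conv_rhs => rw [hammingDist, Finset.card_filter, Fin.sum_univ_castSucc, mul_add, Finset.mul_sum]
  gcongr
  · exact hy _ _ _ _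
  · exact hz _ _ _

/-- For fixed `b` and a fixed `c ∈ P`, the words over adjacent `a`, `a' ∈ M` are at distance at
most `2`, so they lie in different parts of a splitting; hence a splitting of the code gives a
splitting of `M`. -/
lemma not_isSplittable_phelpsCode {r : ℕ} {M : Finset (Word (r + 1) 4)} {P : Finset (Word r 2)}
    (hM : ¬ IsSplittableMDS M) (hP : IsPerfectCode 1 P) :
    ¬ IsSplittable (phelpsCode (r * 4 + 3) M P) := by
  rintro ⟨A, B, hA, hB, hAB⟩
  obtain ⟨c, hc⟩ : P.Nonempty := by
    obtain ⟨c, hc⟩ := Finset.card_pos.1 (by rw [hP 0]; exact one_pos)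
    exact ⟨c, (Finset.mem_filter.1 hc).1⟩
  let φ : Word (r + 1) 4 → Word (r * 4 + 3) 2 := fun a => phelpsWord (r * 4 + 3) a c 0
  have hφ : Function.Injective φ := by
    intro a a' h
    funext j
    refine Fin.lastCases ?_ (fun i => ?_) j
    · have h' := congrArg lastBlock h
      simp only [φ, lastBlock_phelpsWord] at h'
      simpa using congrArg zInv h'
    · have h' := congrArg (block · i) h
      simp only [φ, block_phelpsWord] at h'
      simpa using congrArg yInv h'
  have key : ∀ C : Finset (Word (r * 4 + 3) 2), IsPerfectCode 1 C → ∀ T : Finset (Word (r + 1) 4),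
      (∀ a ∈ T, φ a ∈ C) → (hammingGraph (r + 1) 4).IsIndepSet (T : Set (Word (r + 1) 4)) := by
    intro C hC T hT a ha a' ha' hne hadj
    refine hne (hφ (hC.eq_of_hammingDist_le_two (hT a ha) (hT a' ha') ?_))
    have hd : hammingDist a a' = 1 := hadj
    exact (hammingDist_phelpsWord_le a a' c 0).trans (by omega)
  refine hM ⟨M.filter (φ · ∈ A), M.filter (φ · ∉ A), key A hA _ fun a ha =>
    (Finset.mem_filter.1 ha).2, key B hB _ fun a ha => ?_, Finset.disjoint_filter_filter_not _ _ _,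
    (Finset.filter_union_filter_not_eq _ _).symm⟩
  obtain ⟨ha, hnA⟩ := Finset.mem_filter.1 ha
  have hmem : φ a ∈ A ∪ B := hAB ▸ phelpsWord_mem _ ha hc 0
  exact (Finset.mem_union.1 hmem).resolve_left hnA

/-- Flipping the last coordinate exchanges the symbols `0`, `1` and the symbols `2`, `3` in the
last position of `a`. -/
lemma push_zero_mem_phelpsCode_iff {r : ℕ} {M : Finset (Word (r + 1) 4)} {P : Finset (Word r 2)}
    (hM : ∀ x, (push x 0 ∈ M ↔ push x 1 ∈ M) ∧ (push x 2 ∈ M ↔ push x 3 ∈ M))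
    (x : Word (r * 4 + 2) 2) :
    push x 0 ∈ phelpsCode (r * 4 + 3) M P ↔ push x 1 ∈ phelpsCode (r * 4 + 3) M P := by
  have hflip : push x 1 = flip (push x 0) (lastPos 2) := (flip_push_last x 0).symm
  have hz : ∀ a b, ∃ b', flip (z a b) 2 = z ((![1, 0, 3, 2] : Fin 4 → Fin 4) a) b' := by decide
  rw [hflip]
  generalize (push x 0 : Word (r * 4 + 3) 2) = w
  rw [mem_phelpsCode, mem_phelpsCode, cWord_flip_lastPos, aWord_flip_lastPos]
  obtain ⟨b', hb'⟩ := hz (zInv (lastBlock w)).1 (zInv (lastBlock w)).2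
  rw [z_zInv] at hb'
  rw [hb', zInv_z, aWord, update_push_last]
  refine and_congr_left fun _ => ?_
  have h := hM fun i => (yInv (block w i)).1
  generalize (zInv (lastBlock w)).1 = s
  fin_cases s
  exacts [h.1, h.1.symm, h.2, h.2.symm]

/-! ### Hamming codes -/

/-- The Hamming code: the words whose syndrome vanishes. -/
lemma exists_isPerfectCode_one (r s : ℕ) (hr : r + 1 = 2 ^ s) :
    ∃ P : Finset (Word r 2), IsPerfectCode 1 P := by
  classical
  have hcard : Fintype.card (Fin r) = Fintype.card {g : Fin s → ZMod 2 // g ≠ 0} := by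
    simp only [ne_eq, Fintype.card_subtype_compl, Fintype.card_subtype_eq, Fintype.card_pi,
      ZMod.card, Fintype.card_fin, Finset.prod_const, Finset.card_univ]
    omega
  -- The columns of the parity-check matrix are all nonzero vectors.
  let e : Fin r ≃ {g : Fin s → ZMod 2 // g ≠ 0} := Fintype.equivOfCardEq hcard
  let syn : Word r 2 → Fin s → ZMod 2 := fun x =>
    ∑ i, if x i = 1 then (e i : Fin s → ZMod 2) else 0
  have hdouble : ∀ g : Fin s → ZMod 2, g + g = 0 := fun g =>
    funext fun _ => CharTwo.add_self_eq_zero _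
  have hsyn : ∀ x i, syn (flip x i) = syn x + e i := by
    intro x i
    have hbit : ∀ a : Fin 2, ¬ (a + 1 = 1 ↔ a = 1) := by decide
    simp only [syn]
    rw [← Finset.add_sum_erase _ _ (Finset.mem_univ i),
      ← Finset.add_sum_erase (a := i) _ (fun i => if x i = 1 then (e i : Fin s → ZMod 2) else 0)
        (Finset.mem_univ i), flip_self, add_right_comm]
    congr 1
    · have := hbit (x i)
      by_cases h : x i = 1
      · have h' : ¬ x i + 1 = 1 := by tauto
        rw [if_pos h, if_neg h', hdouble]
      · have h' : x i + 1 = 1 := by tauto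
        rw [if_pos h', if_neg h, zero_add]
    · refine Finset.sum_congr rfl fun j hj => ?_
      rw [flip_of_ne x (Finset.ne_of_mem_erase hj)]
  refine ⟨Finset.univ.filter fun x => syn x = 0, (isPerfectCode_iff _).2 fun x => ?_⟩
  have hzero : ∀ i, syn x + e i = 0 ↔ (e i : Fin s → ZMod 2) = syn x := by
    intro i
    have h := add_right_inj (syn x) (b := (e i : Fin s → ZMod 2)) (c := syn x)
    rwa [hdouble] at h
  simp only [Finset.mem_filter, Finset.mem_univ, true_and, hsyn, hzero]
  by_cases h : syn x = 0
  · rw [if_pos h, Finset.sum_eq_zero fun i _ => if_neg fun hi => (e i).2 (hi.trans h), add_zero]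
  · have hi : ∀ i, (e i : Fin s → ZMod 2) = syn x ↔ e.symm ⟨syn x, h⟩ = i := by
      intro i
      rw [Equiv.symm_apply_eq, Subtype.ext_iff, eq_comm]
    rw [if_neg h]
    simp only [hi]
    simp

/-! ### The shortened code -/

/-- If `E|0 ∪ E|1` is a twofold `1`-perfect code, then a vertex has no neighbours in `E` if it
belongs to `E`, and two otherwise. -/
lemma ball_count_shorten {n : ℕ} {D : Finset (Word (n + 1) 2)} (hD : IsPerfectCode 2 D)
    (hinv : ∀ x : Word n 2, push x 0 ∈ D ↔ push x 1 ∈ D) (x : Word n 2) :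
    2 * (if x ∈ shorten D 0 then 1 else 0) +
      ∑ i, (if flip x i ∈ shorten D 0 then 1 else 0) = 2 := by
  have h := (isPerfectCode_iff D).1 hD (push x 0)
  rw [Fin.sum_univ_castSucc] at h
  simp only [flip_push_castSucc, flip_push_last, zero_add, ← hinv] at h
  simp only [shorten, Finset.mem_filter, Finset.mem_univ, true_and]
  omega

/-- The subcube of the binary words that agree with `v` in the positions of `S`. -/
def subcube {n : ℕ} (S : Finset (Fin n)) (v : Word n 2) : Finset (Word n 2) :=
  Finset.univ.filter fun x => ∀ i ∈ S, x i = v i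

lemma card_subcube {n : ℕ} (S : Finset (Fin n)) (v : Word n 2) :
    (subcube S v).card * 2 ^ S.card = 2 ^ n := by
  have h : subcube S v = Fintype.piFinset fun i => if i ∈ S then {v i} else Finset.univ := by
    ext x
    simp only [subcube, Finset.mem_filter, Finset.mem_univ, true_and, Fintype.mem_piFinset]
    refine forall_congr' fun i => ?_
    by_cases hi : i ∈ S <;> simp [hi]
  have h2 : ∀ i, (if i ∈ S then {v i} else (Finset.univ : Finset (Fin 2))).card =
      if i ∈ S then 1 else 2 := by
    intro i
    by_cases hi : i ∈ S <;> simp [hi]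
  rw [h, Fintype.card_piFinset, Finset.prod_congr rfl fun i _ => h2 i, Finset.prod_ite]
  simp only [Finset.prod_const_one, one_mul, Finset.prod_const]
  rw [← pow_add]
  congr 1
  have := Finset.card_filter_add_card_filter_not (s := (Finset.univ : Finset (Fin n))) (· ∈ S)
  simp only [Finset.filter_univ_mem, Finset.card_univ, Fintype.card_fin] at this
  omega

lemma flip_mem_subcube_flip {n : ℕ} {S : Finset (Fin n)} {v x : Word n 2} (i : Fin n) :
    flip x i ∈ subcube S (flip v i) ↔ x ∈ subcube S v := by
  simp only [subcube, Finset.mem_filter, Finset.mem_univ, true_and]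
  refine forall_congr' fun j => imp_congr_right fun _ => ?_
  by_cases hj : j = i
  · subst hj
    simp
  · rw [flip_of_ne _ hj, flip_of_ne _ hj]

lemma subcube_flip {n : ℕ} {S : Finset (Fin n)} {i : Fin n} (hi : i ∉ S) (v : Word n 2) :
    subcube S (flip v i) = subcube S v := by
  ext x
  simp only [subcube, Finset.mem_filter, Finset.mem_univ, true_and]
  refine forall_congr' fun j => imp_congr_right fun hj => ?_
  rw [flip_of_ne]
  rintro rfl
  exact hi hj

/-- The local count of `ball_count_shorten`, summed over a subcube. -/
lemma sum_card_subcube_inter {n : ℕ} {E : Finset (Word n 2)}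
    (hE : ∀ x : Word n 2,
      2 * (if x ∈ E then 1 else 0) + ∑ i, (if flip x i ∈ E then 1 else 0) = 2)
    (S : Finset (Fin n)) (v : Word n 2) :
    2 * ((subcube S v).filter (· ∈ E)).card +
      ∑ i, ((subcube S (flip v i)).filter (· ∈ E)).card = 2 * (subcube S v).card := by
  have h : ∀ i, ((subcube S (flip v i)).filter (· ∈ E)).card =
      ∑ x ∈ subcube S v, if flip x i ∈ E then 1 else 0 := by
    intro i
    rw [Finset.card_filter]
    refine Finset.sum_nbij' (flip · i) (flip · i) (fun x hx => ?_) (fun x hx => ?_)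
      (fun x _ => flip_flip x i) (fun x _ => flip_flip x i) fun x _ => by simp
    · rw [← flip_mem_subcube_flip i, flip_flip]
      exact hx
    · exact (flip_mem_subcube_flip i).2 hx
  rw [Finset.sum_congr rfl fun i _ => h i, Finset.sum_comm, Finset.card_filter, Finset.mul_sum,
    ← Finset.sum_add_distrib, Finset.sum_congr rfl fun x _ => hE x, Finset.sum_const, smul_eq_mul,
    mul_comm]

/-- All subcubes of small codimension contain the same number of words of `E`: by
`sum_card_subcube_inter`, a linear system with a dominant diagonal determines these numbers. -/
lemma card_subcube_inter {n : ℕ} {E : Finset (Word n 2)}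
    (hE : ∀ x : Word n 2,
      2 * (if x ∈ E then 1 else 0) + ∑ i, (if flip x i ∈ E then 1 else 0) = 2)
    (S : Finset (Fin n)) (hS : 2 * S.card < n + 2) (v : Word n 2) :
    ((subcube S v).filter (· ∈ E)).card * 2 ^ S.card * (n + 2) = 2 ^ (n + 1) := by
  let F : Word n 2 → ℕ := fun v => ((subcube S v).filter (· ∈ E)).card
  have hsplit : ∀ v, (n + 2) * F v + ∑ i ∈ S, F (flip v i) =
      2 * (subcube S v).card + S.card * F v := by
    intro v
    have hcard := Finset.card_add_card_compl S
    rw [Fintype.card_fin] at hcard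
    have h0 : ∑ i ∈ Sᶜ, F (flip v i) = Sᶜ.card * F v := by
      rw [Finset.sum_congr rfl fun i hi => by
        simp only [F]
        rw [subcube_flip (Finset.mem_compl.1 hi)], Finset.sum_const, smul_eq_mul]
    have h1 : 2 * F v + ∑ i, F (flip v i) = 2 * (subcube S v).card :=
      sum_card_subcube_inter hE S v
    rw [← Finset.sum_add_sum_compl S, h0] at h1
    have h2 : n * F v = S.card * F v + Sᶜ.card * F v := by rw [← add_mul, hcard]
    rw [← h1, add_mul, h2]
    ring
  have hU : ∀ v w, (subcube S v).card = (subcube S w).card := fun v w =>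
    Nat.eq_of_mul_eq_mul_right (by positivity) ((card_subcube S v).trans (card_subcube S w).symm)
  obtain ⟨v₁, -, h₁⟩ := Finset.exists_max_image Finset.univ F Finset.univ_nonempty
  obtain ⟨v₂, -, h₂⟩ := Finset.exists_min_image Finset.univ F Finset.univ_nonempty
  -- Comparing the equations at a maximum and at a minimum of `F` shows that they coincide.
  have hlow : S.card * F v₂ ≤ ∑ i ∈ S, F (flip v₁ i) := by
    simpa using Finset.card_nsmul_le_sum S _ (F v₂) fun i _ => h₂ (flip v₁ i) (Finset.mem_univ _)
  have hhigh : ∑ i ∈ S, F (flip v₂ i) ≤ S.card * F v₁ := by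
    simpa using Finset.sum_le_card_nsmul S _ (F v₁) fun i _ => h₁ (flip v₂ i) (Finset.mem_univ _)
  have he₁ := hsplit v₁
  have he₂ := hsplit v₂
  rw [hU v₂ v₁] at he₂
  have hle : F v₁ ≤ F v₂ := by
    by_contra! hlt
    nlinarith
  have hconst : ∀ w, F w = F v := fun w =>
    le_antisymm ((h₁ w (Finset.mem_univ _)).trans (hle.trans (h₂ v (Finset.mem_univ _))))
      ((h₁ v (Finset.mem_univ _)).trans (hle.trans (h₂ w (Finset.mem_univ _))))
  have he := hsplit v
  rw [Finset.sum_congr rfl fun i _ => hconst (flip v i), Finset.sum_const, smul_eq_mul] at he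
  have he' : (n + 2) * F v = 2 * (subcube S v).card := Nat.add_right_cancel he
  calc F v * 2 ^ S.card * (n + 2) = (n + 2) * F v * 2 ^ S.card := by ring
    _ = 2 ^ (n + 1) := by rw [he', mul_assoc, card_subcube, pow_succ']

lemma isOrthogonalArray_of_ball_count {n m : ℕ} (hm : 1 ≤ m) (hn : n + 2 = 2 ^ m)
    {E : Finset (Word n 2)}
    (hE : ∀ x : Word n 2,
      2 * (if x ∈ E then 1 else 0) + ∑ i, (if flip x i ∈ E then 1 else 0) = 2) :
    IsOrthogonalArray (2 ^ (2 ^ m - m - 1)) n 2 (2 ^ (m - 1) - 1) E.val := by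
  obtain ⟨l, rfl⟩ : ∃ l, m = l + 1 := ⟨m - 1, by omega⟩
  have hlt := Nat.lt_two_pow_self (n := l)
  have hpow : 2 ^ (l + 1) = 2 * 2 ^ l := pow_succ' 2 l
  have key : ∀ S : Finset (Fin n), 2 * S.card < n + 2 → ∀ v,
      ((subcube S v).filter (· ∈ E)).card * 2 ^ S.card = 2 ^ (2 ^ (l + 1) - (l + 1) - 1) := by
    intro S hS v
    have h := card_subcube_inter hE S hS v
    refine Nat.eq_of_mul_eq_mul_right (show 0 < n + 2 by omega) (h.trans ?_)
    rw [hn, ← pow_add]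
    congr 1
    omega
  refine ⟨by simp only [Nat.add_sub_cancel]; omega, ?_, fun S hS v => ?_⟩
  · have h := key ∅ (by simp) 0
    simpa [subcube] using h
  · rw [Nat.add_sub_cancel] at hS
    rw [← key S (by omega) v, hS, Nat.add_sub_cancel]
    congr 1
    rw [Multiset.countP_eq_card_filter, subcube, Finset.filter_filter]
    change (E.filter fun x => ∀ i ∈ S, x i = v i).card = _
    congr 1
    ext x
    simp [and_comm]

/-- Flipping the last coordinate of a `1`-perfect code gives a `1`-perfect code. -/
lemma IsPerfectCode.swap_last {n l : ℕ} {A B : Finset (Word n 2)}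
    (h : IsPerfectCode l (pushAll A 0 ∪ pushAll B 1)) :
    IsPerfectCode l (pushAll B 0 ∪ pushAll A 1) := by
  rw [isPerfectCode_iff] at h ⊢
  intro w
  have hmem : ∀ w, w ∈ pushAll B 0 ∪ pushAll A 1 ↔
      flip w (Fin.last n) ∈ pushAll A 0 ∪ pushAll B 1 := by
    intro w
    obtain ⟨x, s, rfl⟩ := exists_eq_push w
    simp only [flip_push_last, Finset.mem_union, push_mem_pushAll]
    fin_cases s <;> simp
  have hcomm : ∀ i, flip (flip w i) (Fin.last n) = flip (flip w (Fin.last n)) i := by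
    intro i
    by_cases hi : i = Fin.last n
    · rw [hi]
    · simp only [flip, Function.update_of_ne (Ne.symm hi), Function.update_of_ne hi]
      exact Function.update_comm hi _ _ _
  simpa only [hmem, hcomm] using h (flip w (Fin.last n))

/-- If `E = C' ∪ C''` with `C'|0 ∪ C''|1` perfect, then `E|0 ∪ E|1` is the union of
`C'|0 ∪ C''|1` and `C''|0 ∪ C'|1`. -/
lemma not_isPuncturedPerfectCode_shorten {n : ℕ} {D : Finset (Word (n + 1) 2)}
    (hinv : ∀ x : Word n 2, push x 0 ∈ D ↔ push x 1 ∈ D) (hD : ¬ IsSplittable D) :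
    ¬ IsPuncturedPerfectCode (shorten D 0) := by
  rintro ⟨A, B, hAB, h⟩
  refine hD ⟨_, _, h, h.swap_last, ?_⟩
  ext w
  obtain ⟨x, s, rfl⟩ := exists_eq_push w
  have hx : push x s ∈ D ↔ x ∈ A ∪ B := by
    rw [← hAB]
    simp only [shorten, Finset.mem_filter, Finset.mem_univ, true_and]
    fin_cases s
    exacts [Iff.rfl, (hinv x).symm]
  rw [hx]
  simp only [Finset.mem_union, push_mem_pushAll]
  fin_cases s <;> simp [or_comm]

end PhelpsArray

theorem theorem6p1 (m r n : ℕ) (hm : 4 ≤ m) (hr : r + 1 = 2 ^ (m - 2)) (hn : n = 2 ^ m - 2) :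
    -- the orthogonal array
    (∃ C : Finset (PhelpsArray.Word n 2),
      PhelpsArray.IsOrthogonalArray (2 ^ (2 ^ m - m - 1)) n 2 (2 ^ (m - 1) - 1) C.val ∧
      ¬ PhelpsArray.IsPuncturedPerfectCode C) ∧
    -- the special `2`-fold MDS code `M_k`, where `k = r + 1 = 2 ^ (m - 2)`
    (PhelpsArray.IsTwoFoldMDS (PhelpsArray.specialMDS (r + 1)) ∧
      ¬ PhelpsArray.IsSplittableMDS (PhelpsArray.specialMDS (r + 1)) ∧
      ∀ x : PhelpsArray.Word r 4,
        (PhelpsArray.push x 0 ∈ PhelpsArray.specialMDS (r + 1) ↔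
          PhelpsArray.push x 1 ∈ PhelpsArray.specialMDS (r + 1)) ∧
        (PhelpsArray.push x 2 ∈ PhelpsArray.specialMDS (r + 1) ↔
          PhelpsArray.push x 3 ∈ PhelpsArray.specialMDS (r + 1))) ∧
    -- the construction: some `1`-perfect code `P` of length `k - 1` exists, and any one will do
    (∃ P : Finset (PhelpsArray.Word r 2), PhelpsArray.IsPerfectCode 1 P) ∧
    ∀ P : Finset (PhelpsArray.Word r 2), PhelpsArray.IsPerfectCode 1 P →
      ∀ D : Finset (PhelpsArray.Word (n + 1) 2),
        D = PhelpsArray.phelpsCode (n + 1) (PhelpsArray.specialMDS (r + 1)) P →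
        PhelpsArray.IsPerfectCode 2 D ∧
        ¬ PhelpsArray.IsSplittable D ∧
        (∀ x : PhelpsArray.Word n 2, PhelpsArray.push x 0 ∈ D ↔ PhelpsArray.push x 1 ∈ D) ∧
        PhelpsArray.IsOrthogonalArray (2 ^ (2 ^ m - m - 1)) n 2 (2 ^ (m - 1) - 1)
          (PhelpsArray.shorten D 0).val ∧
        ¬ PhelpsArray.IsPuncturedPerfectCode (PhelpsArray.shorten D 0) := by
  obtain ⟨s, rfl⟩ : ∃ s, m = s + 4 := ⟨m - 4, by omega⟩
  have hpow : 2 ^ (s + 4) = 4 * 2 ^ (s + 2) := by ring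
  have hs : 2 ^ (s + 2) = 4 * 2 ^ s := by ring
  have hpos : 0 < 2 ^ s := by positivity
  rw [show s + 4 - 2 = s + 2 by omega] at hr
  obtain rfl : n = r * 4 + 2 := by omega
  obtain ⟨k, rfl⟩ : ∃ k, r = k + 3 := ⟨r - 3, by omega⟩
  have hP := PhelpsArray.exists_isPerfectCode_one (k + 3) (s + 2) hr
  have hM := PhelpsArray.isTwoFoldMDS_specialMDS (k + 1)
  have hM' := PhelpsArray.not_isSplittableMDS_specialMDS (k + 1)
  have hpair : ∀ x : PhelpsArray.Word (k + 3) 4,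
      (PhelpsArray.push x 0 ∈ PhelpsArray.specialMDS (k + 3 + 1) ↔
        PhelpsArray.push x 1 ∈ PhelpsArray.specialMDS (k + 3 + 1)) ∧
      (PhelpsArray.push x 2 ∈ PhelpsArray.specialMDS (k + 3 + 1) ↔
        PhelpsArray.push x 3 ∈ PhelpsArray.specialMDS (k + 3 + 1)) := by
    intro x
    simp only [PhelpsArray.push_mem_specialMDS_add_four]
    exact ⟨Iff.rfl, Iff.rfl⟩
  have main : ∀ P : Finset (PhelpsArray.Word (k + 3) 2), PhelpsArray.IsPerfectCode 1 P →
      ∀ D : Finset (PhelpsArray.Word ((k + 3) * 4 + 2 + 1) 2),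
        D = PhelpsArray.phelpsCode ((k + 3) * 4 + 2 + 1) (PhelpsArray.specialMDS (k + 3 + 1)) P →
        PhelpsArray.IsPerfectCode 2 D ∧
        ¬ PhelpsArray.IsSplittable D ∧
        (∀ x : PhelpsArray.Word ((k + 3) * 4 + 2) 2,
          PhelpsArray.push x 0 ∈ D ↔ PhelpsArray.push x 1 ∈ D) ∧
        PhelpsArray.IsOrthogonalArray (2 ^ (2 ^ (s + 4) - (s + 4) - 1)) ((k + 3) * 4 + 2) 2
          (2 ^ (s + 4 - 1) - 1) (PhelpsArray.shorten D 0).val ∧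
        ¬ PhelpsArray.IsPuncturedPerfectCode (PhelpsArray.shorten D 0) := by
    rintro P hP D rfl
    have h₁ := PhelpsArray.isPerfectCode_phelpsCode hM hP
    have h₂ := PhelpsArray.not_isSplittable_phelpsCode hM' hP
    have h₃ := PhelpsArray.push_zero_mem_phelpsCode_iff (P := P) hpair
    exact ⟨h₁, h₂, h₃, PhelpsArray.isOrthogonalArray_of_ball_count (by omega) (by omega)
      (PhelpsArray.ball_count_shorten h₁ h₃), PhelpsArray.not_isPuncturedPerfectCode_shorten h₃ h₂⟩
  obtain ⟨P, hP'⟩ := hP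
  obtain ⟨-, -, -, hOA, hpunct⟩ := main P hP' _ rfl
  exact ⟨⟨_, hOA, hpunct⟩, ⟨hM, hM', hpair⟩, ⟨P, hP'⟩, main⟩
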